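/- Let $\mathcal U$ be a saturated structure in a first-order language $L$ (every finitely satisfiable set of formulas, in a finite tuple of variables, with parameters from a set $A\subseteq\mathcal U$ with $|A|<|\mathcal U|$, is realized in $\mathcal U$) whose cardinality is uncountable, (strongly) inaccessible and larger than $|L|$, and let $T=\mathrm{Th}(\mathcal U)$. Say that a family $u$ of subsets of a set $X$ *shatters* $B\subseteq X$ if every $H\subseteq B$ is of the form $C\cap B$ with $C\in u$, and that $u$ has *finite VC-dimension* if for some $k<\omega$ no $B\subseteq X$ of size $k$ is shattered by $u$. Assume that $T$ is NIP, i.e. for every formula $\varphi(x,z)\in L$ in finite tuples of variables, the family $\{\varphi(b,\mathcal U): b\in\mathcal U^{|x|}\}$ of subsets of $\mathcal U^{|z|}$ has finite VC-dimension. Let $z$ be a finite tuple of variables and let $\mathcal D\subseteq\mathcal U^{|z|}$ be arbitrary. Let $e(\mathcal D)$ be the set of all $\mathcal C\subseteq\mathcal U^{|z|}$ such that the expansions $\langle\mathcal U,\mathcal C\rangle$ and $\langle\mathcal U,\mathcal D\rangle$ of $\mathcal U$ by one new $|z|$-ary predicate are elementarily equivalent. Then the following are equivalent: 1. $\mathcal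 D$ is approximable from below: there is a formula $\varphi(x,z)\in L$, with $x$ a finite tuple, such that for every finite $B\subseteq\mathcal U$ there is $b\in\mathcal U^{|x|}$ with $\varphi(b,\mathcal U)\cap B^{|z|}=\mathcal D\cap B^{|z|}$ and $\varphi(b,\mathcal U)\subseteq\mathcal D$; 2. $e(\mathcal D)$ has finite VC-dimension; 3. $\mathcal D$ is externally definable: there are a finite tuple $x$, a complete global type $p\in S_x(\mathcal U)$ and a formula $\varphi(x,z)\in L$ such that $\mathcal D=\{a\in\mathcal U^{|z|}:\varphi(x,a)\in p\}$. -/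

import Mathlib

open FirstOrder Cardinal

universe u v w

namespace ExtDef

/-- The family `u` shatters `B`: every subset of `B` is the trace over `B` of some member of `u`. -/
def Shatters {α : Type*} (u : Set (Set α)) (B : Set α) : Prop :=
  ∀ H : Set α, H ⊆ B → ∃ C ∈ u, C ∩ B = H

/-- The family `u` has finite VC-dimension: for some `k`, no set of size `k` is shattered. -/
def FiniteVCDim {α : Type*} (u : Set (Set α)) : Prop :=
  ∃ k : ℕ, ∀ B : Finset α, B.card = k → ¬ Shatters u (B : Set α)

/-- `M` is a saturated `L`-structure: for every `A ⊆ M` with `|A| < |M|`, every set of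
`L(A)`-formulas in finitely many variables which is finitely satisfiable in `M` is realized
in `M`. -/
def IsSaturated (L : FirstOrder.Language.{u, v}) (M : Type w) [L.Structure M] : Prop :=
  ∀ A : Set M, #A < #M → ∀ (m : ℕ) (p : Set (L[[A]].Formula (Fin m))),
    (∀ F : Finset (L[[A]].Formula (Fin m)), (F : Set (L[[A]].Formula (Fin m))) ⊆ p →
      ∃ v : Fin m → M, ∀ φ ∈ F, φ.Realize v) →
    ∃ v : Fin m → M, ∀ φ ∈ p, φ.Realize v

/-- The set `φ(b, M) ⊆ Mⁿ`, for a formula `φ(x, z)` and a tuple `b` in place of `x`. -/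
def fiber {L : FirstOrder.Language.{u, v}} {M : Type w} [L.Structure M] {m n : ℕ}
    (φ : L.Formula (Fin m ⊕ Fin n)) (b : Fin m → M) : Set (Fin n → M) :=
  {z | φ.Realize (Sum.elim b z)}

/-- The formula `φ(x, z)` is NIP (in `M`): the sets `φ(b, M)` form a family of finite
VC-dimension. -/
def IsNIPFormula {L : FirstOrder.Language.{u, v}} (M : Type w) [L.Structure M] {m n : ℕ}
    (φ : L.Formula (Fin m ⊕ Fin n)) : Prop :=
  FiniteVCDim (Set.range (fun b : Fin m → M => fiber φ b))

/-- The theory of `M` is NIP: every formula is NIP in `M`. -/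
def IsNIP (L : FirstOrder.Language.{u, v}) (M : Type w) [L.Structure M] : Prop :=
  ∀ (m n : ℕ) (φ : L.Formula (Fin m ⊕ Fin n)), IsNIPFormula M φ

/-- The power `Bⁿ`, as a set of `n`-tuples of `M`. -/
def cube {M : Type w} (B : Set M) (n : ℕ) : Set (Fin n → M) :=
  {z | ∀ i, z i ∈ B}

/-- `D` is approximable from below by `φ(x, z)`: for every finite `B` there is a tuple `b` such
that `φ(b, M)` and `D` have the same trace over `B`, and `φ(b, M) ⊆ D`. -/
def ApproximableFromBelowBy {L : FirstOrder.Language.{u, v}} {M : Type w} [L.Structure M] {m n : ℕ}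
    (φ : L.Formula (Fin m ⊕ Fin n)) (D : Set (Fin n → M)) : Prop :=
  ∀ B : Set M, B.Finite →
    ∃ b : Fin m → M, fiber φ b ∩ cube B n = D ∩ cube B n ∧ fiber φ b ⊆ D

/-- `D` is approximable from below by some formula, the same one for all finite sets. -/
def ApproximableFromBelow (L : FirstOrder.Language.{u, v}) {M : Type w} [L.Structure M] {n : ℕ}
    (D : Set (Fin n → M)) : Prop :=
  ∃ (m : ℕ) (φ : L.Formula (Fin m ⊕ Fin n)), ApproximableFromBelowBy φ D

/-- The formula `φ(x, a)` over `M`, for a formula `φ(x, z)` and a tuple `a` in place of `z`. -/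
def instantiate {L : FirstOrder.Language.{u, v}} {M : Type w} {m n : ℕ}
    (φ : L.Formula (Fin m ⊕ Fin n)) (a : Fin n → M) : L[[M]].Formula (Fin m) :=
  ((L.lhomWithConstants M).onFormula φ).subst
    (Sum.elim (fun i => FirstOrder.Language.Term.var i)
      (fun j => FirstOrder.Language.Constants.term (FirstOrder.Language.con L (a j))))

/-- `D` is externally definable: there are a global type `p ∈ S_x(M)`, with `x` a finite tuple of
variables, and a formula `φ(x, z)` such that `D = {a | φ(x, a) ∈ p}`. -/
def ExternallyDefinable (L : FirstOrder.Language.{u, v}) {M : Type w} [L.Structure M] {n : ℕ}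
    (D : Set (Fin n → M)) : Prop :=
  ∃ (m : ℕ) (p : (L.elementaryDiagram M).CompleteType (Fin m)) (φ : L.Formula (Fin m ⊕ Fin n)),
    D = {a | FirstOrder.Language.Formula.equivSentence (instantiate φ a) ∈ p}

/-- The only relation symbol of `predLanguage n`, of arity `n`. -/
inductive PredRel (n : ℕ) : ℕ → Type
  | mem : PredRel n n

/-- The language with one `n`-ary predicate. -/
abbrev predLanguage (n : ℕ) : FirstOrder.Language.{0, 0} where
  Functions _ := Empty
  Relations := PredRel n

/-- The interpretation of the predicate as `z ∈ D`. -/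
abbrev predStructure {M : Type w} {n : ℕ} (D : Set (Fin n → M)) : (predLanguage n).Structure M where
  funMap f _ := Empty.elim f
  RelMap R :=
    match R with
    | .mem => fun z => z ∈ D

/-- The expansion `⟨M, D⟩` of the `L`-structure `M` by a predicate for `z ∈ D`. -/
abbrev expansion (L : FirstOrder.Language.{u, v}) {M : Type w} [L.Structure M] {n : ℕ}
    (D : Set (Fin n → M)) : (L.sum (predLanguage n)).Structure M :=
  letI := predStructure D
  L.sumStructure (predLanguage n) M

/-- `e(D)`: the collection of all `C` such that `⟨M, C⟩` and `⟨M, D⟩` are elementarily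
equivalent. -/
def eClass (L : FirstOrder.Language.{u, v}) {M : Type w} [L.Structure M] {n : ℕ}
    (D : Set (Fin n → M)) : Set (Set (Fin n → M)) :=
  {C | @FirstOrder.Language.ElementarilyEquivalent (L.sum (predLanguage n)) M M
    (expansion L C) (expansion L D)}

end ExtDef

/-!
Assume that `D` is not approximable from below. The sets on which it is form an ideal, so some
ultrafilter `W` containing `D` avoids them all. Every definable set in the power `Wᵏ` then contains
`k`-tuples with any prescribed pattern of membership in `D`, and saturation yields a single
`k`-tuple `c` in `U` whose type is that of `Wᵏ`. So each pattern on `c` is consistent with the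
theory of `⟨U, D⟩` together with the elementary diagram of `U`. Saturated structures are
resplendent: a Henkin construction inside `U`, in which the witnesses are elements of `U`, realizes
this theory by an expansion `⟨U, C⟩`. Hence `C ∈ e(D)` has the given trace on `c`, and `e(D)`
shatters sets of every finite size.

Conversely, that on every family of `k` tuples `D` has the same trace as some `φ(b, U)` is expressed
by a sentence about `⟨U, D⟩`, hence holds for every member of `e(D)`, whose VC-dimension is thus
bounded by that of `φ`. By compactness this property, for all `k`, is also equivalent to external
definability by `φ`.
-/

namespace ExtDef

open FirstOrder.Language

universe x y u' v'

section Consistency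

variable {L : FirstOrder.Language.{u, v}} {α : Type x} {T : L.Theory}

theorem realize_iff_of_eqOn_freeVarFinset [DecidableEq α] {M : Type y} [L.Structure M] {n : ℕ}
    (φ : L.BoundedFormula α n) {g g' : α → M} (h : ∀ a ∈ φ.freeVarFinset, g a = g' a)
    (xs : Fin n → M) : φ.Realize g xs ↔ φ.Realize g' xs := by
  have restrict (k : α → M) :
      (φ.restrictFreeVar id).Realize (fun a => k a) xs ↔ φ.Realize k xs :=
    BoundedFormula.realize_restrictFreeVar k fun _ => rfl
  rw [← restrict g, ← restrict g', funext fun a : φ.freeVarFinset => h a a.2]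

/-- The set `S` of formulas with free variables in `α` is consistent with the theory `T`: it is
realized by an assignment in some model of `T`. The variables are encoded as new constants, so that
this is the satisfiability of a theory. -/
def IsConsistent (T : L.Theory) (S : Set (L.Formula α)) : Prop :=
  Theory.IsSatisfiable ((L.lhomWithConstants α).onTheory T ∪ Formula.equivSentence '' S)

theorem IsConsistent.of_realize {S : Set (L.Formula α)} (M : Type y) [L.Structure M] [Nonempty M]
    (hM : M ⊨ T) (g : α → M) (h : ∀ φ ∈ S, φ.Realize g) : IsConsistent T S := by
  let _ : (constantsOn α).Structure M := constantsOn.structure g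
  have hT : M ⊨ (L.lhomWithConstants α).onTheory T := (LHom.onTheory_model _ _).2 hM
  have hS : Theory.Model (L := L[[α]]) M (Formula.equivSentence '' S) :=
    ⟨Set.forall_mem_image.2 fun φ hφ => (Formula.realize_equivSentence M φ).2 (h φ hφ)⟩
  have := hT.union hS
  exact Theory.Model.isSatisfiable M

theorem IsConsistent.exists_realize {S : Set (L.Formula α)} (h : IsConsistent T S) :
    ∃ (N : Type (max u v x)) (_ : L.Structure N), Nonempty N ∧ N ⊨ T ∧
      ∃ g : α → N, ∀ φ ∈ S, φ.Realize g := by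
  obtain ⟨M⟩ := h
  let _ : L.Structure M := (L.lhomWithConstants α).reduct M
  have : (L.lhomWithConstants α).IsExpansionOn M := LHom.isExpansionOn_reduct _ _
  obtain ⟨hT, hS⟩ := Theory.model_union_iff.1 M.is_model
  exact ⟨M, inferInstance, M.nonempty', (LHom.onTheory_model _ _).1 hT, fun a => (L.con a : M),
    fun φ hφ => (Formula.realize_equivSentence M φ).1 (hS.realize_of_mem _ ⟨φ, hφ, rfl⟩)⟩

theorem IsConsistent.mono {S S' : Set (L.Formula α)} (h : IsConsistent T S') (hS : S ⊆ S') :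
    IsConsistent T S :=
  Theory.IsSatisfiable.mono h (Set.union_subset_union_right _ (Set.image_mono hS))

theorem isConsistent_of_forall_finite {S : Set (L.Formula α)}
    (h : ∀ F ⊆ S, F.Finite → IsConsistent T F) : IsConsistent T S := by
  refine Theory.isSatisfiable_iff_isFinitelySatisfiable.2 fun T₀ hT₀ => ?_
  have hfin : (Formula.equivSentence ⁻¹' (T₀ : L[[α]].Theory)).Finite :=
    T₀.finite_toSet.preimage Formula.equivSentence.injective.injOn
  refine Theory.IsSatisfiable.mono (h _ Set.inter_subset_right (hfin.inter_of_left S)) ?_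
  intro σ hσ
  rcases hT₀ hσ with hσT | ⟨φ, hφ, rfl⟩
  · exact Or.inl hσT
  · exact Or.inr ⟨φ, ⟨hσ, hφ⟩, rfl⟩

end Consistency

section Extension

variable {L : FirstOrder.Language.{u, v}} {β : Type x} {U : Type w} {N : Type y}
  [L.Structure U] [L.Structure N]

theorem exists_formula_extending [Nonempty N] (e : β → U) {χ : L.Formula U} (hχ : χ.Realize id) :
    ∃ ψ : L.Formula β, ψ.Realize e ∧ ∀ f : β → N, f.FactorsThrough e → ψ.Realize f →
      ∃ g : U → N, g ∘ e = f ∧ χ.Realize g := by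
  classical
  let var : χ.freeVarFinset → β ⊕ χ.freeVarFinset := fun a =>
    if h : ∃ b, e b = a then Sum.inl h.choose else Sum.inr a
  refine ⟨Formula.iExs χ.freeVarFinset (χ.restrictFreeVar var), Formula.realize_iExs.2
    ⟨(↑), ?_⟩, fun f hf hψ => ?_⟩
  · refine (BoundedFormula.realize_restrictFreeVar id fun a => ?_).2 hχ
    simp only [var]
    split_ifs with h
    exacts [h.choose_spec, rfl]
  · obtain ⟨i, hi⟩ := Formula.realize_iExs.1 hψ
    let g := Function.extend e f (Function.extend (↑) i fun _ => Classical.arbitrary N)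
    refine ⟨g, hf.extend_comp _, (BoundedFormula.realize_restrictFreeVar g fun a => ?_).1 hi⟩
    simp only [var, g, Function.extend_def e]
    split_ifs with h
    exacts [rfl, (Subtype.val_injective.extend_apply i _ a).symm]

theorem exists_realize_extending [Nonempty N] {e : β → U} {f : β → N}
    (h : ∀ ψ : L.Formula β, ψ.Realize e → ψ.Realize f) {χ : L.Formula U} (hχ : χ.Realize id) :
    ∃ g : U → N, g ∘ e = f ∧ χ.Realize g := by
  obtain ⟨ψ, hψ, hext⟩ := exists_formula_extending (N := N) e hχ
  refine hext f (fun b b' hb => ?_) (h ψ hψ)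
  exact Formula.realize_equal.1
    (h ((Term.var b).equal (Term.var b')) (Formula.realize_equal.2 hb))

theorem exists_formula_extending_of_finite [Finite β] [Nonempty N] (e : β → U) {χ : L.Formula U}
    (hχ : χ.Realize id) :
    ∃ ψ : L.Formula β, ψ.Realize e ∧ ∀ f : β → N, ψ.Realize f →
      ∃ g : U → N, g ∘ e = f ∧ χ.Realize g := by
  obtain ⟨ψ, hψ, hext⟩ := exists_formula_extending (N := N) e hχ
  let sameEqualities : L.Formula β := Formula.iInf fun p : {p : β × β // e p.1 = e p.2} =>
    (Term.var p.1.1).equal (Term.var p.1.2)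
  refine ⟨ψ ⊓ sameEqualities, Formula.realize_inf.2 ⟨hψ, Formula.realize_iInf.2 fun p =>
    Formula.realize_equal.2 p.2⟩, fun f hf => ?_⟩
  obtain ⟨hfψ, hfe⟩ := Formula.realize_inf.1 hf
  refine hext f (fun b b' hb => ?_) hfψ
  exact Formula.realize_equal.1 (Formula.realize_iInf.1 hfe ⟨(b, b'), hb⟩)

end Extension

section Saturation

variable {L : FirstOrder.Language.{u, v}} {U : Type w} [L.Structure U] {ι : Type x} [Finite ι]

theorem IsSaturated.exists_realize (hU : IsSaturated L U) {A : Set U} (hA : #A < #U)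
    {p : Set (L.Formula (A ⊕ ι))}
    (hp : ∀ F ⊆ p, F.Finite → ∃ y : ι → U, ∀ φ ∈ F, φ.Realize (Sum.elim (↑) y)) :
    ∃ y : ι → U, ∀ φ ∈ p, φ.Realize (Sum.elim (↑) y) := by
  classical
  let e := Finite.equivFin ι
  let encode : L.Formula (A ⊕ ι) → L[[A]].Formula (Fin (Nat.card ι)) := fun φ =>
    BoundedFormula.constantsVarsEquiv.symm (φ.relabel (Sum.map id e))
  have realize_encode (φ : L.Formula (A ⊕ ι)) (y : Fin (Nat.card ι) → U) :
      (encode φ).Realize y ↔ φ.Realize (Sum.elim (↑) (y ∘ e)) := by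
    rw [Formula.Realize, ← BoundedFormula.realize_constantsVarsEquiv, Equiv.apply_symm_apply]
    refine Formula.realize_relabel.trans (iff_of_eq ?_)
    rw [Sum.elim_comp_map]
    rfl
  obtain ⟨y, hy⟩ := hU A hA _ (encode '' p) fun F hF => by
    obtain ⟨F, hFp, rfl⟩ := Finset.subset_set_image_iff.1 hF
    obtain ⟨y, hy⟩ := hp F hFp F.finite_toSet
    refine ⟨y ∘ e.symm, Finset.forall_mem_image.2 fun φ hφ => (realize_encode φ _).2 ?_⟩
    rw [Function.comp_assoc, e.symm_comp_self, Function.comp_id]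
    exact hy φ hφ
  exact ⟨y ∘ e, fun φ hφ => (realize_encode φ y).1 (hy _ ⟨φ, hφ, rfl⟩)⟩

theorem IsSaturated.exists_realize_iff (hU : IsSaturated L U) {A : Set U} (hA : #A < #U)
    {N : Type y} [L.Structure N] {g : U → N}
    (hg : ∀ χ : L.Formula U, χ.Realize g ↔ χ.Realize id) (x : ι → N) :
    ∃ y : ι → U, ∀ ψ : L.Formula (A ⊕ ι),
      ψ.Realize (Sum.elim (↑) y) ↔ ψ.Realize (Sum.elim (fun a => g a) x) := by
  obtain ⟨y, hy⟩ := hU.exists_realize hA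
      (p := {ψ | ψ.Realize (Sum.elim (fun a => g a) x)}) fun F hF hfin => by
    have : Finite F := hfin
    let existsF : L.Formula A := (Formula.iInf fun φ : F => φ.1).iExs ι
    have hN : existsF.Realize (g ∘ (↑)) :=
      Formula.realize_iExs.2 ⟨x, Formula.realize_iInf.2 fun φ => hF φ.2⟩
    have hU := (hg (existsF.relabel (↑))).1 (Formula.realize_relabel.2 hN)
    obtain ⟨y, hy⟩ := Formula.realize_iExs.1 (Formula.realize_relabel.1 hU)
    exact ⟨y, fun φ hφ => Formula.realize_iInf.1 hy ⟨φ, hφ⟩⟩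
  exact ⟨y, fun ψ => ⟨fun h => by_contra fun hn => hy ψ.not hn h, hy ψ⟩⟩

theorem IsSaturated.exists_realize_of_ultrafilter [Nonempty U] (hU : IsSaturated L U)
    (V : Ultrafilter (ι → U)) :
    ∃ y : ι → U, ∀ ψ : L.Formula ι, ψ.Realize y → ∀ᶠ s : ι → U in V, ψ.Realize s := by
  obtain ⟨y, hy⟩ := hU.exists_realize (A := ∅) (by simp [pos_iff_ne_zero])
      (p := {φ | ∀ᶠ s : ι → U in V, φ.Realize (Sum.elim (↑) s)}) fun F hF hfin =>
    ((Filter.eventually_all_finite hfin).2 fun φ hφ => hF hφ).exists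
  refine ⟨y, fun ψ hψ => by_contra fun hn => ?_⟩
  have hrelabel (s : ι → U) : (ψ.not.relabel (Sum.inr : ι → (∅ : Set U) ⊕ ι)).Realize
      (Sum.elim (↑) s) ↔ ¬ ψ.Realize s := by
    rw [Formula.realize_relabel, Sum.elim_comp_inr, Formula.realize_not]
  exact (hrelabel y).1 (hy _ ((Ultrafilter.eventually_not.2 hn).mono fun s => (hrelabel s).2)) hψ

end Saturation

section HenkinExpansion

variable {L : FirstOrder.Language.{u, v}} {L' : FirstOrder.Language.{u', v'}} {ℓ : L →ᴸ L'}
  {T : L'.Theory} {U : Type w}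

open scoped Classical in
/-- The parameters occurring in a set of formulas over `U`. -/
def parameters (S : Set (L'.Formula U)) : Set U :=
  ⋃ φ : S, BoundedFormula.freeVarFinset φ.1

theorem parameters_union (S S' : Set (L'.Formula U)) :
    parameters (S ∪ S') = parameters S ∪ parameters S' := by
  simp only [parameters, Set.iUnion_coe_set, Set.biUnion_union]

theorem mk_union_lt [Infinite U] {A B : Set U} (hA : #A < #U) (hB : #B < #U) : #↥(A ∪ B) < #U :=
  (mk_union_le A B).trans_lt (add_lt_of_lt (aleph0_le_mk U) hA hB)

theorem mk_iUnion_lt_of_finite [Infinite U] {ι : Type x} {s : ι → Set U} (hs : ∀ i, (s i).Finite)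
    (hι : lift.{w} #ι < lift.{x} #U) : #(⋃ i, s i) < #U := by
  rcases finite_or_infinite ι with _ | _
  · exact (lt_aleph0_iff_set_finite.2 (Set.finite_iUnion hs)).trans_le (aleph0_le_mk U)
  rw [← lift_lt.{w, x}]
  refine (mk_iUnion_le_sum_mk_lift.trans ?_).trans_lt hι
  calc sum (fun i => #(s i)) ≤ sum fun _ : ι => ℵ₀ :=
        sum_le_sum _ _ fun i => (lt_aleph0_iff_set_finite.2 (hs i)).le
    _ = lift.{w} #ι := by
        rw [sum_const, lift_aleph0, mul_aleph0_eq (aleph0_le_lift.2 (aleph0_le_mk ι))]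

theorem mk_parameters_lt [Infinite U] {S : Set (L'.Formula U)}
    (hS : #S < lift.{max u' v'} #U) : #(parameters S) < #U :=
  mk_iUnion_lt_of_finite (fun _ => Finset.finite_toSet _)
    (by rwa [lift_id'.{w, max u' v'}, lift_umax.{w, max u' v'}])

variable [L.Structure U]

variable (ℓ U) in
/-- The elementary diagram of the `L`-structure `U`, as a set of formulas of an expansion `L'` of
`L`, with the elements of `U` as free variables. -/
def diagram : Set (L'.Formula U) :=
  ℓ.onFormula '' {χ : L.Formula U | χ.Realize id}

theorem realize_iff_of_realize_diagram {N : Type y} [L.Structure N] [L'.Structure N]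
    [ℓ.IsExpansionOn N] {g : U → N} (h : ∀ φ ∈ diagram ℓ U, φ.Realize g) (χ : L.Formula U) :
    χ.Realize g ↔ χ.Realize id := by
  have realize_of_true {χ : L.Formula U} (hχ : χ.Realize id) : χ.Realize g :=
    (LHom.realize_onFormula ℓ χ).1 (h _ ⟨χ, hχ, rfl⟩)
  exact ⟨fun hg => by_contra fun hn => realize_of_true (χ := χ.not) hn hg, realize_of_true⟩

theorem isConsistent_diagram_union {S : Set (L'.Formula U)}
    (h : ∀ χ : L.Formula U, χ.Realize id → IsConsistent T (insert (ℓ.onFormula χ) S)) :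
    IsConsistent T (diagram ℓ U ∪ S) := by
  refine isConsistent_of_forall_finite fun F hFS hF => ?_
  choose χ hχ hχF using fun φ : ↥(F ∩ diagram ℓ U) => φ.2.2
  have : Finite ↥(F ∩ diagram ℓ U) := hF.inter_of_left _
  obtain ⟨N, _, _, hT, g, hg⟩ := (h (Formula.iInf χ) (Formula.realize_iInf.2 hχ)).exists_realize
  let _ : L.Structure N := ℓ.reduct N
  have hgχ := (LHom.realize_onFormula ℓ _).1 (hg _ (Set.mem_insert _ _))
  refine IsConsistent.of_realize N hT g fun φ hφ => ?_
  by_cases hd : φ ∈ diagram ℓ U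
  · have hφχ : ℓ.onFormula (χ ⟨φ, hφ, hd⟩) = φ := hχF _
    exact hφχ ▸ (LHom.realize_onFormula ℓ _).2 (Formula.realize_iInf.1 hgχ _)
  · exact hg _ (Set.mem_insert_of_mem _ ((hFS hφ).resolve_left hd))

/-- The Henkin formula `∃ x φ(x) → φ(c)`. The instance `φ(c)` is written `∃ x (x = c ∧ φ(x))`, to
spare a substitution. -/
def henkin (φ : L'.BoundedFormula U 1) (c : U) : L'.Formula U :=
  φ.ex ⟹ ((Term.var (Sum.inr 0) =' Term.var (Sum.inl c)) ⊓ φ).ex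

theorem realize_henkin {N : Type y} [L'.Structure N] (φ : L'.BoundedFormula U 1) (c : U)
    (g : U → N) :
    (henkin φ c).Realize g ↔ ((∃ x, φ.Realize g fun _ => x) → φ.Realize g fun _ => g c) := by
  have snoc_eq (x : N) : Fin.snoc default x = fun _ : Fin 1 => x := by
    funext i
    fin_cases i
    rfl
  simp [henkin, Formula.Realize, BoundedFormula.realize_ex, snoc_eq]

open scoped Classical in
theorem exists_isConsistent_insert_henkin [Nonempty U] (hU : IsSaturated L U)
    {S : Set (L'.Formula U)} (φ : L'.BoundedFormula U 1)
    (hA : #↥(parameters S ∪ φ.freeVarFinset) < #U) (hS : IsConsistent T (diagram ℓ U ∪ S)) :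
    ∃ c, IsConsistent T (diagram ℓ U ∪ insert (henkin φ c) S) := by
  obtain ⟨N, _, _, hT, g, hg⟩ := hS.exists_realize
  let _ : L.Structure N := ℓ.reduct N
  obtain ⟨x, hx⟩ : ∃ x, (∃ x, φ.Realize g fun _ => x) → φ.Realize g fun _ => x :=
    ⟨Classical.epsilon fun x => φ.Realize g fun _ => x, Classical.epsilon_spec⟩
  obtain ⟨y, hy⟩ := hU.exists_realize_iff hA
    (realize_iff_of_realize_diagram fun φ hφ => hg φ (Or.inl hφ)) fun _ : Unit => x
  refine ⟨y (), isConsistent_diagram_union fun χ hχ => ?_⟩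
  obtain ⟨g', hg', hχg'⟩ := exists_realize_extending (fun ψ => (hy ψ).1) hχ
  have eq_on_parameters {a : U} (ha : a ∈ parameters S ∪ φ.freeVarFinset) : g' a = g a :=
    congrFun hg' (Sum.inl ⟨a, ha⟩)
  have hc : g' (y ()) = x := congrFun hg' (Sum.inr ())
  have hφ := realize_iff_of_eqOn_freeVarFinset φ (fun a ha => eq_on_parameters (Or.inr ha))
  refine IsConsistent.of_realize N hT g' ?_
  rintro ψ (rfl | rfl | hψ)
  · exact (LHom.realize_onFormula ℓ χ).2 hχg'
  · rw [realize_henkin, hc]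
    simpa only [hφ] using hx
  · exact (realize_iff_of_eqOn_freeVarFinset ψ (fun a ha => eq_on_parameters
      (Or.inl (Set.mem_iUnion.2 ⟨⟨ψ, hψ⟩, ha⟩))) _).2 (hg ψ (Or.inr hψ))

end HenkinExpansion

section Recursion

theorem exists_forall_of_forall_update {I : Type x} {V : Type y} [LinearOrder I] [WellFoundedLT I]
    [Nonempty V] {P : I → (I → V) → Prop}
    (hcongr : ∀ i f f', Set.EqOn f f' (Set.Iic i) → P i f → P i f')
    (hext : ∀ i f, (∀ j < i, P j f) → ∃ c, P i (Function.update f i c)) : ∃ f, ∀ i, P i f := by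
  classical
  let below (i : I) (f : ∀ j, j < i → V) : I → V := fun j =>
    if h : j < i then f j h else Classical.arbitrary V
  let f : I → V := WellFoundedLT.fix fun i ih =>
    Classical.epsilon fun c => P i (Function.update (below i ih) i c)
  have f_eq (i : I) : f i = Classical.epsilon fun c =>
      P i (Function.update (below i fun j _ => f j) i c) :=
    WellFoundedLT.fix_eq _ i
  have below_eq {i j : I} (hj : j < i) : below i (fun j _ => f j) j = f j := dif_pos hj
  refine ⟨f, fun i => ?_⟩
  induction i using WellFoundedLT.induction with | ind i ih
  have hP := Classical.epsilon_spec (hext i (below i fun j _ => f j) fun j hj =>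
    hcongr j f _ (fun k hk => (below_eq (lt_of_le_of_lt hk hj)).symm) (ih j hj))
  rw [← f_eq] at hP
  refine hcongr i _ _ (fun j hj => ?_) hP
  rcases eq_or_lt_of_le hj with rfl | hlt
  · exact Function.update_self ..
  · rw [Function.update_of_ne hlt.ne, below_eq hlt]

theorem IsConsistent.union_image_of_forall_Iic {L : FirstOrder.Language.{u, v}} {T : L.Theory}
    {α : Type x} {I : Type y} [LinearOrder I] {J : Set I} {S : Set (L.Formula α)}
    {f : I → L.Formula α} (hS : IsConsistent T S)
    (h : ∀ j ∈ J, IsConsistent T (S ∪ f '' Set.Iic j)) : IsConsistent T (S ∪ f '' J) := by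
  refine isConsistent_of_forall_finite fun F hFS hF => ?_
  obtain ⟨J', hJ', hfin, hFJ'⟩ : ∃ J' ⊆ J, J'.Finite ∧ F ⊆ S ∪ f '' J' := by
    obtain ⟨J', hJ', hfin, heq⟩ := Set.exists_subset_image_finite_and.1
      ⟨F ∩ f '' J, Set.inter_subset_right, hF.inter_of_left _, rfl⟩
    refine ⟨J', hJ', hfin, fun φ hφ => (hFS hφ).imp_right fun hφJ => ?_⟩
    exact heq ▸ ⟨hφ, hφJ⟩
  rcases J'.eq_empty_or_nonempty with rfl | hne
  · exact hS.mono (by simpa using hFJ')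
  obtain ⟨j, hj, hmax⟩ := hfin.exists_maximal hne
  exact (h j (hJ' hj)).mono (hFJ'.trans (Set.union_subset_union_right _ (Set.image_mono
    fun i hi => (le_total i j).elim id fun hle => hmax hi hle)))

end Recursion

section Resplendence

variable {L : FirstOrder.Language.{u, v}} {L' : FirstOrder.Language.{u', v'}} {ℓ : L →ᴸ L'}
  {T : L'.Theory} {U : Type w} [L.Structure U]

theorem meetsDefinable_range_of_realize_henkin {N : Type y} [L'.Structure N] {g : U → N}
    {c : L'.BoundedFormula U 1 → U} (hc : ∀ φ, (henkin φ (c φ)).Realize g) :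
    L'.MeetsDefinable (Set.range g) := by
  rintro D ⟨x, hx⟩ hD
  obtain ⟨φ, hφ⟩ := Set.definable_iff_exists_formula_sum.1 hD
  let ψ : L'.BoundedFormula U 1 :=
    BoundedFormula.relabel (n := 1) (k := 0) (Sum.map (Set.rangeSplitting g) id) φ
  have realize_ψ (z : N) : ψ.Realize g (fun _ => z) ↔ z ∈ D := by
    refine Iff.trans ?_ (Set.ext_iff.1 hφ fun _ => z).symm
    refine BoundedFormula.realize_relabel.trans (iff_of_eq ?_)
    rw [Sum.elim_comp_map, Set.comp_rangeSplitting]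
    exact congrArg (BoundedFormula.Realize φ (Sum.elim (↑) fun _ => z)) (Subsingleton.elim _ _)
  exact ⟨g (c ψ), (realize_ψ _).1 ((realize_henkin ψ _ g).1 (hc ψ) ⟨x, (realize_ψ x).2 hx⟩),
    Set.mem_range_self _⟩

theorem exists_structure_elementaryEmbedding {N : Type y} [L'.Structure N] {g : U → N}
    (hinj : g.Injective) (hg : L'.MeetsDefinable (Set.range g)) :
    ∃ (_ : L'.Structure U) (e : U ↪ₑ[L'] N), ⇑e = g := by
  let K := hg.toElementarySubstructure
  have hK : (K : Set N) = Set.range g := hg.closure_eq_self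
  let e : U ≃ K := (Equiv.ofInjective g hinj).trans (Equiv.setCongr hK.symm)
  let _ : L'.Structure U := e.symm.inducedStructure
  exact ⟨_, K.subtype.comp e.symm.inducedStructureEquiv.symm.toElementaryEmbedding, rfl⟩

theorem isExpansionOn_of_coe_eq {N : Type y} [L.Structure N] [L'.Structure U] [L'.Structure N]
    [ℓ.IsExpansionOn N] (e : U ↪[L] N) (e' : U ↪[L'] N) (h : ⇑e' = e) : ℓ.IsExpansionOn U where
  map_onFunction f x := e.injective (by
    rw [e.map_fun, ← h, e'.map_fun, LHom.map_onFunction])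
  map_onRelation R x := by
    rw [← e.map_rel, ← h, ← LHom.map_onRelation ℓ R (e' ∘ x), e'.map_rel]

variable [Infinite U] {S : Set (L'.Formula U)}

theorem lift_mk_boundedFormula_le (hL : lift.{w} L'.card ≤ lift.{max u' v'} #U) (n : ℕ) :
    #(L'.BoundedFormula U n) ≤ lift.{max u' v'} #U := by
  have hU : ℵ₀ ≤ lift.{max u' v'} #U := aleph0_le_lift.2 (aleph0_le_mk U)
  calc #(L'.BoundedFormula U n) ≤ #(Σ k, L'.BoundedFormula U k) :=
        mk_le_of_injective (f := Sigma.mk n) sigma_mk_injective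
    _ ≤ max ℵ₀ (lift.{max u' v'} #U + lift.{w} L'.card) := BoundedFormula.card_le
    _ ≤ lift.{max u' v'} #U := max_le hU (add_le_of_le hU le_rfl hL)

theorem IsSaturated.exists_henkin_choice (hU : IsSaturated L U)
    (hL : lift.{w} L'.card ≤ lift.{max u' v'} #U) (hS : #(parameters S) < #U)
    (hcons : IsConsistent T (diagram ℓ U ∪ S)) :
    ∃ c : L'.BoundedFormula U 1 → U,
      IsConsistent T (diagram ℓ U ∪ S ∪ Set.range fun φ => henkin φ (c φ)) := by
  obtain ⟨_, _, hord⟩ := exists_ord_eq_type_lt (L'.BoundedFormula U 1)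
  let P : L'.BoundedFormula U 1 → (L'.BoundedFormula U 1 → U) → Prop := fun φ c =>
    IsConsistent T (diagram ℓ U ∪ S ∪ (fun ψ => henkin ψ (c ψ)) '' Set.Iic φ)
  obtain ⟨c, hc⟩ : ∃ c, ∀ φ, P φ c := by
    refine exists_forall_of_forall_update (fun φ c c' hcc' hφ => ?_) fun φ c hlt => ?_
    · have : (fun ψ => henkin ψ (c ψ)) '' Set.Iic φ = (fun ψ => henkin ψ (c' ψ)) '' Set.Iic φ :=
        Set.image_congr fun ψ hψ => by rw [hcc' hψ]
      simpa only [P, this] using hφ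
    · have hIio := hcons.union_image_of_forall_Iic (J := Set.Iio φ) hlt
      have hIio_lt := (mk_Iio_lt φ hord).trans_le (lift_mk_boundedFormula_le hL 1)
      rw [Set.union_assoc] at hIio
      obtain ⟨b, hb⟩ := exists_isConsistent_insert_henkin hU φ (by
        rw [parameters_union]
        exact mk_union_lt (mk_union_lt hS (mk_parameters_lt (mk_image_le.trans_lt hIio_lt)))
          ((lt_aleph0_iff_set_finite.2 (Finset.finite_toSet _)).trans_le (aleph0_le_mk U))) hIio
      refine ⟨b, hb.mono ?_⟩
      have hupdate : (fun ψ => henkin ψ (Function.update c φ b ψ)) '' Set.Iio φ =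
          (fun ψ => henkin ψ (c ψ)) '' Set.Iio φ :=
        Set.image_congr fun ψ hψ => by rw [Function.update_of_ne hψ.ne]
      rw [← Set.Iio_insert, Set.image_insert_eq, Function.update_self, hupdate, Set.union_insert,
        Set.union_assoc, Set.union_insert]
  refine ⟨c, ?_⟩
  rw [← Set.image_univ]
  exact hcons.union_image_of_forall_Iic fun φ _ => hc φ

theorem IsSaturated.exists_expansion (hU : IsSaturated L U)
    (hL : lift.{w} L'.card ≤ lift.{max u' v'} #U) (hS : #(parameters S) < #U)
    (hcons : IsConsistent T (diagram ℓ U ∪ S)) :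
    ∃ _ : L'.Structure U, ℓ.IsExpansionOn U ∧ U ⊨ T ∧ ∀ φ ∈ S, φ.Realize id := by
  obtain ⟨c, hc⟩ := hU.exists_henkin_choice hL hS hcons
  obtain ⟨N, _, _, hT, g, hg⟩ := hc.exists_realize
  let _ : L.Structure N := ℓ.reduct N
  have hdiag := realize_iff_of_realize_diagram fun φ hφ => hg φ (Or.inl (Or.inl hφ))
  let e : U ↪ₑ[L] N := ⟨g, fun n φ x => by
    rw [← Formula.realize_relabel, hdiag, Formula.realize_relabel, Function.id_comp]⟩
  obtain ⟨_, e', he'⟩ := exists_structure_elementaryEmbedding e.injective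
    (meetsDefinable_range_of_realize_henkin fun φ => hg _ (Or.inr ⟨φ, rfl⟩))
  refine ⟨_, isExpansionOn_of_coe_eq e.toEmbedding e'.toEmbedding he',
    (e'.theory_model_iff T).2 hT, fun φ hφ => ?_⟩
  rw [← e'.map_formula, Function.comp_id, he']
  exact hg φ (Or.inl (Or.inr hφ))

end Resplendence

section Expansion

variable {L : FirstOrder.Language.{u, v}} {U : Type w} {n : ℕ}

theorem lift_card_sum_predLanguage_le [Infinite U]
    (hL : lift.{w} L.card ≤ lift.{max u v} #U) :
    lift.{w} (L.sum (predLanguage n)).card ≤ lift.{max u v} #U := by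
  have hU : ℵ₀ ≤ lift.{max u v} #U := aleph0_le_lift.2 (aleph0_le_mk U)
  have hpred : (predLanguage n).card ≤ 1 := by
    rw [Language.card, le_one_iff_subsingleton]
    refine ⟨?_⟩
    rintro (⟨_, ⟨⟩⟩ | ⟨_, ⟨⟩⟩) (⟨_, ⟨⟩⟩ | ⟨_, ⟨⟩⟩)
    rfl
  rw [Language.card_sum, lift_add]
  refine add_le_of_le hU (by simpa using hL) (le_trans ?_ hU)
  simpa using hpred.trans one_le_aleph0

variable [L.Structure U]

theorem expansion_isExpansionOn (D : Set (Fin n → U)) :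
    letI := expansion L D
    (LHom.sumInl : L →ᴸ L.sum (predLanguage n)).IsExpansionOn U :=
  letI := expansion L D
  ⟨fun _ _ => rfl, fun _ _ => rfl⟩

variable (L n) in
/-- The new predicate of the expanded language. -/
abbrev predSymbol : (L.sum (predLanguage n)).Relations n := Sum.inr PredRel.mem

theorem exists_eq_expansion [inst : (L.sum (predLanguage n)).Structure U]
    [(LHom.sumInl : L →ᴸ L.sum (predLanguage n)).IsExpansionOn U] :
    ∃ C : Set (Fin n → U), inst = expansion L C := by
  refine ⟨{z | Structure.RelMap (predSymbol L n) z}, ?_⟩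
  refine Structure.ext (funext₂ fun m f => ?_) (funext₂ fun m R => ?_)
  · rcases f with f | f
    · exact funext (LHom.map_onFunction (LHom.sumInl : L →ᴸ L.sum (predLanguage n)) f)
    · exact f.elim
  · rcases R with R | R
    · exact funext (LHom.map_onRelation (LHom.sumInl : L →ᴸ L.sum (predLanguage n)) R)
    · cases R
      rfl

variable (L) in
/-- The atomic formula saying that the tuple of variables `z` belongs to the predicate. -/
def memFormula {α : Type x} (z : Fin n → α) : (L.sum (predLanguage n)).Formula α :=
  (predSymbol L n).formula fun i => Term.var (z i)

theorem realize_memFormula {α : Type x} {N : Type y} [(L.sum (predLanguage n)).Structure N]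
    (z : Fin n → α) (g : α → N) :
    (memFormula L z).Realize g ↔ Structure.RelMap (predSymbol L n) (g ∘ z) := by
  rw [memFormula, Formula.realize_rel]
  rfl

open scoped Classical in
theorem IsSaturated.exists_mem_eClass_trace [Infinite U] (hU : IsSaturated L U)
    (hL : lift.{w} L.card ≤ lift.{max u v} #U) {D : Set (Fin n → U)} {ι : Type x} [Finite ι]
    {c : ι → Fin n → U} {S : Set ι}
    (h : ∀ χ : L.Formula U, χ.Realize id →
      ∃ g : U → U, χ.Realize g ∧ ∀ i, g ∘ c i ∈ D ↔ i ∈ S) :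
    ∃ C ∈ eClass L D, ∀ i, c i ∈ C ↔ i ∈ S := by
  let T : (L.sum (predLanguage n)).Theory :=
    letI := expansion L D
    (L.sum (predLanguage n)).completeTheory U
  let pattern : ι → (L.sum (predLanguage n)).Formula U := fun i =>
    if i ∈ S then memFormula L (c i) else (memFormula L (c i)).not
  have realize_pattern [(L.sum (predLanguage n)).Structure U] (g : U → U) (i : ι) :
      (pattern i).Realize g ↔ (Structure.RelMap (predSymbol L n) (g ∘ c i) ↔ i ∈ S) := by
    by_cases hi : i ∈ S <;> simp [pattern, hi, realize_memFormula]
  have hcons : IsConsistent T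
      (diagram (LHom.sumInl : L →ᴸ L.sum (predLanguage n)) U ∪ Set.range pattern) := by
    refine isConsistent_diagram_union fun χ hχ => ?_
    obtain ⟨g, hg, hgD⟩ := h χ hχ
    let _ := expansion L D
    have := expansion_isExpansionOn (L := L) D
    refine IsConsistent.of_realize U model_completeTheory g ?_
    rintro φ (rfl | ⟨i, rfl⟩)
    · exact (LHom.realize_onFormula _ _).2 hg
    · exact (realize_pattern g i).2 (hgD i)
  obtain ⟨_, _, hT, hpattern⟩ := hU.exists_expansion (lift_card_sum_predLanguage_le hL)
    (mk_parameters_lt ((lt_aleph0_iff_set_finite.2 (Set.finite_range _)).trans_le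
      (aleph0_le_lift.2 (aleph0_le_mk U)))) hcons
  obtain ⟨C, rfl⟩ := exists_eq_expansion (L := L) (U := U) (n := n)
  let _ := expansion L C
  exact ⟨C, Set.ext fun σ => @realize_iff_of_model_completeTheory _ U U (expansion L D) _ hT σ,
    fun i => (realize_pattern id i).1 (hpattern _ ⟨i, rfl⟩)⟩

end Expansion

section VCDimension

variable {α : Type x} {u : Set (Set α)}

theorem FiniteVCDim.of_forall_finite {v : Set (Set α)} (hv : FiniteVCDim v)
    (h : ∀ C ∈ u, ∀ B : Set α, B.Finite → ∃ C' ∈ v, C' ∩ B = C ∩ B) : FiniteVCDim u := by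
  obtain ⟨k, hk⟩ := hv
  refine ⟨k, fun B hB hshatters => hk B hB fun H hH => ?_⟩
  obtain ⟨C, hC, rfl⟩ := hshatters H hH
  exact h C hC B B.finite_toSet

theorem shatters_range {ι : Type y} {c : ι → α}
    (h : ∀ S : Set ι, ∃ C ∈ u, ∀ i, c i ∈ C ↔ i ∈ S) : Shatters u (Set.range c) := by
  intro H hH
  obtain ⟨C, hC, hCH⟩ := h (c ⁻¹' H)
  have hpreimage : c ⁻¹' C = c ⁻¹' H := Set.ext hCH
  exact ⟨C, hC, by rw [← Set.image_preimage_eq_inter_range, hpreimage,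
    Set.image_preimage_eq_of_subset hH]⟩

theorem injective_of_forall_exists_mem_iff {ι : Type y} {c : ι → α}
    (h : ∀ S : Set ι, ∃ C ∈ u, ∀ i, c i ∈ C ↔ i ∈ S) : c.Injective := by
  intro i j hij
  obtain ⟨C, -, hC⟩ := h {i}
  exact ((hC j).1 (hij ▸ (hC i).2 rfl)).symm

theorem not_finiteVCDim_of_forall_exists (h : ∀ k, ∃ c : Fin k → α, ∀ S : Set (Fin k),
    ∃ C ∈ u, ∀ i, c i ∈ C ↔ i ∈ S) : ¬ FiniteVCDim u := by
  rintro ⟨k, hk⟩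
  obtain ⟨c, hc⟩ := h k
  refine hk (Finset.univ.map ⟨c, injective_of_forall_exists_mem_iff hc⟩) (by simp) ?_
  simpa using shatters_range hc

end VCDimension

section Approximability

variable {L : FirstOrder.Language.{u, v}} {U : Type w} [L.Structure U] {m n : ℕ}
  {φ : L.Formula (Fin m ⊕ Fin n)} {D : Set (Fin n → U)}

/-- The set `D` is approximable by `φ(x, z)`: over every finite set of tuples, `D` has the same
trace as some `φ(b, U)`. Unlike in `ApproximableFromBelowBy`, `φ(b, U)` may leave `D`. -/
def ApproximableBy (φ : L.Formula (Fin m ⊕ Fin n)) (D : Set (Fin n → U)) : Prop :=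
  ∀ F : Set (Fin n → U), F.Finite → ∃ b : Fin m → U, ∀ z ∈ F, z ∈ fiber φ b ↔ z ∈ D

theorem ApproximableFromBelowBy.approximableBy (h : ApproximableFromBelowBy φ D) :
    ApproximableBy φ D := by
  intro F hF
  obtain ⟨b, hb, -⟩ := h (⋃ z ∈ F, Set.range z) (hF.biUnion fun z _ => Set.finite_range z)
  refine ⟨b, fun z hz => ?_⟩
  have hcube : z ∈ cube (⋃ z ∈ F, Set.range z) n := fun i => Set.mem_biUnion hz ⟨i, rfl⟩
  exact ⟨fun h => (hb.subset ⟨h, hcube⟩).1, fun h => (hb.superset ⟨h, hcube⟩).1⟩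

/-- The sentence saying that over every family of tuples indexed by `ι` the predicate has the same
trace as some instance `φ(b, z)`. -/
noncomputable def traceSentence (φ : L.Formula (Fin m ⊕ Fin n)) (ι : Type x) [Finite ι] :
    (L.sum (predLanguage n)).Sentence :=
  Formula.iAlls (ι × Fin n) (Formula.iExs (Fin m) (Formula.iInf fun i : ι =>
    Formula.iff
      (((LHom.sumInl : L →ᴸ L.sum (predLanguage n)).onFormula φ).relabel
        (Sum.elim Sum.inr fun j => Sum.inl (Sum.inr (i, j))))
      (memFormula L fun j => (Sum.inl (Sum.inr (i, j)) : (Empty ⊕ (ι × Fin n)) ⊕ Fin m))))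

theorem realize_traceSentence (φ : L.Formula (Fin m ⊕ Fin n)) (ι : Type x) [Finite ι]
    (D : Set (Fin n → U)) :
    (letI := expansion L D; U ⊨ traceSentence φ ι) ↔
      ∀ z : ι → Fin n → U, ∃ b : Fin m → U, ∀ i, z i ∈ fiber φ b ↔ z i ∈ D := by
  let _ := expansion L D
  have := expansion_isExpansionOn (L := L) D
  rw [traceSentence, Sentence.Realize, Formula.realize_iAlls]
  refine ((Equiv.curry ι (Fin n) U).symm.forall_congr fun {z} => ?_).symm
  rw [Formula.realize_iExs]
  refine exists_congr fun b => ?_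
  rw [Formula.realize_iInf]
  refine forall_congr' fun i => ?_
  rw [Formula.realize_iff, Formula.realize_relabel, LHom.realize_onFormula, realize_memFormula,
    Sum.comp_elim]
  rfl

theorem ApproximableBy.of_mem_eClass {C : Set (Fin n → U)} (h : ApproximableBy φ D)
    (hC : C ∈ eClass L D) : ApproximableBy φ C := by
  intro F hF
  have : Finite F := hF
  have hD := (realize_traceSentence φ F D).2 fun z =>
    (h _ (Set.finite_range z)).imp fun b hb i => hb _ ⟨i, rfl⟩
  obtain ⟨b, hb⟩ := (realize_traceSentence φ F C).1 ((Set.ext_iff.1 hC _).2 hD) (↑)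
  exact ⟨b, fun z hz => hb ⟨z, hz⟩⟩

theorem ApproximableBy.finiteVCDim_eClass (h : ApproximableBy φ D) (hφ : IsNIPFormula U φ) :
    FiniteVCDim (eClass L D) := by
  refine hφ.of_forall_finite fun C hC B hB => ?_
  obtain ⟨b, hb⟩ := h.of_mem_eClass hC B hB
  exact ⟨_, ⟨b, rfl⟩, Set.ext fun z => and_congr_left (hb z)⟩

end Approximability

section ExternalDefinability

variable {L : FirstOrder.Language.{u, v}} {U : Type w} [L.Structure U] {m n : ℕ}

theorem realize_instantiate (φ : L.Formula (Fin m ⊕ Fin n)) (a : Fin n → U) (b : Fin m → U) :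
    (instantiate φ a).Realize b ↔ a ∈ fiber φ b := by
  rw [instantiate, Formula.Realize, BoundedFormula.realize_subst, ← Formula.Realize,
    LHom.realize_onFormula]
  refine iff_of_eq (congrArg φ.Realize (funext fun i => ?_))
  rcases i with i | i
  · rfl
  · exact Term.realize_constants.trans rfl

open scoped Classical in
/-- `φ(x, a)` or its negation, according to whether `a ∈ D`. The set `D` is externally definable by
`φ` through `p` when the type `p` contains all these formulas. -/
noncomputable def signedInstance (φ : L.Formula (Fin m ⊕ Fin n)) (D : Set (Fin n → U))
    (a : Fin n → U) : L[[U]].Formula (Fin m) :=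
  if a ∈ D then instantiate φ a else (instantiate φ a).not

theorem realize_signedInstance {φ : L.Formula (Fin m ⊕ Fin n)} {D : Set (Fin n → U)}
    {a : Fin n → U} {b : Fin m → U} :
    (signedInstance φ D a).Realize b ↔ (a ∈ fiber φ b ↔ a ∈ D) := by
  by_cases ha : a ∈ D <;> simp [signedInstance, ha, realize_instantiate]

theorem equivSentence_signedInstance_mem_iff {φ : L.Formula (Fin m ⊕ Fin n)} {D : Set (Fin n → U)}
    {p : (L.elementaryDiagram U).CompleteType (Fin m)} {a : Fin n → U} :
    Formula.equivSentence (signedInstance φ D a) ∈ p ↔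
      (a ∈ D ↔ Formula.equivSentence (instantiate φ a) ∈ p) := by
  by_cases ha : a ∈ D
  · simp [signedInstance, ha]
  · simp [signedInstance, ha, Formula.equivSentence_not, p.not_mem_iff]

theorem exists_completeType_iff_isConsistent {T : L.Theory} {α : Type x} {S : Set (L.Formula α)} :
    (∃ p : T.CompleteType α, ∀ φ ∈ S, Formula.equivSentence φ ∈ p) ↔ IsConsistent T S := by
  have := (Theory.CompleteType.setOfPred_subset_eq_empty_iff (T := T)
    (Formula.equivSentence '' S)).not
  rw [not_not, ← Ne, ← Set.nonempty_iff_ne_empty] at this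
  rw [IsConsistent, ← this]
  exact exists_congr fun p => Set.forall_mem_image.symm

theorem isConsistent_elementaryDiagram_iff [Nonempty U] {α : Type x} [Finite α]
    {S : Set (L[[U]].Formula α)} :
    IsConsistent (L.elementaryDiagram U) S ↔
      ∀ F ⊆ S, F.Finite → ∃ b : α → U, ∀ φ ∈ F, φ.Realize b := by
  refine ⟨fun h F hFS hF => ?_, fun h => isConsistent_of_forall_finite fun F hFS hF => ?_⟩
  · have : Finite F := hF
    obtain ⟨N, _, _, hT, g, hg⟩ := h.exists_realize
    let existsF : L[[U]].Sentence :=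
      ((Formula.iInf fun φ : F => φ.1).relabel (Sum.inr : α → Empty ⊕ α)).iExs α
    have hN : N ⊨ existsF := by
      refine Formula.realize_iExs.2 ⟨g, ?_⟩
      rw [Formula.realize_relabel, Sum.elim_comp_inr, Formula.realize_iInf]
      exact fun φ => hg φ (hFS φ.2)
    obtain ⟨b, hb⟩ := Formula.realize_iExs.1
      ((realize_iff_of_model_completeTheory U N existsF).1 hN)
    rw [Formula.realize_relabel, Sum.elim_comp_inr, Formula.realize_iInf] at hb
    exact ⟨b, fun φ hφ => hb ⟨φ, hφ⟩⟩
  · obtain ⟨b, hb⟩ := h F hFS hF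
    exact IsConsistent.of_realize U inferInstance b hb

theorem externallyDefinable_iff_exists_approximableBy [Nonempty U] {D : Set (Fin n → U)} :
    ExternallyDefinable L D ↔ ∃ (m : ℕ) (φ : L.Formula (Fin m ⊕ Fin n)), ApproximableBy φ D := by
  refine exists_congr fun m => exists_comm.trans (exists_congr fun φ => ?_)
  calc (∃ p, D = {a | Formula.equivSentence (instantiate φ a) ∈ p})
      ↔ ∃ p : (L.elementaryDiagram U).CompleteType (Fin m),
          ∀ ψ ∈ Set.range (signedInstance φ D), Formula.equivSentence ψ ∈ p := by
        simp only [Set.forall_mem_range, equivSentence_signedInstance_mem_iff, Set.ext_iff,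
          Set.mem_ofPred_eq]
    _ ↔ ∀ F ⊆ Set.range (signedInstance φ D), F.Finite → ∃ b : Fin m → U, ∀ ψ ∈ F, ψ.Realize b :=
        exists_completeType_iff_isConsistent.trans isConsistent_elementaryDiagram_iff
    _ ↔ ApproximableBy φ D := by
        refine ⟨fun h F hF => ?_, fun h F hF hFfin => ?_⟩
        · obtain ⟨b, hb⟩ := h _ (Set.image_subset_range _ F) (hF.image _)
          exact ⟨b, fun a ha => realize_signedInstance.1 (hb _ ⟨a, ha, rfl⟩)⟩
        · obtain ⟨A, -, hA, rfl⟩ := Set.exists_subset_image_finite_and.1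
            ⟨F, hF.trans_eq Set.image_univ.symm, hFfin, rfl⟩
          obtain ⟨b, hb⟩ := h A hA
          exact ⟨b, Set.forall_mem_image.2 fun a ha => realize_signedInstance.2 (hb a ha)⟩

end ExternalDefinability

section LowerApproximation

variable {L : FirstOrder.Language.{u, v}} {U : Type w} [L.Structure U] {n : ℕ}
  {D X Y : Set (Fin n → U)}

theorem exists_fiber_eq {γ : Type x} (φ : L.Formula (γ ⊕ Fin n)) :
    ∃ (m : ℕ) (ψ : L.Formula (Fin m ⊕ Fin n)),
      ∀ b : γ → U, ∃ b' : Fin m → U, fiber ψ b' = {z | φ.Realize (Sum.elim b z)} := by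
  classical
  let params := φ.freeVarFinset.toLeft
  let rename : φ.freeVarFinset → Fin params.card ⊕ Fin n
    | ⟨Sum.inl i, hi⟩ => Sum.inl (params.equivFin ⟨i, Finset.mem_toLeft.2 hi⟩)
    | ⟨Sum.inr j, _⟩ => Sum.inr j
  refine ⟨params.card, φ.restrictFreeVar rename, fun b =>
    ⟨fun i => b (params.equivFin.symm i), Set.ext fun z => ?_⟩⟩
  refine BoundedFormula.realize_restrictFreeVar (φ := φ) (Sum.elim b z) ?_
  rintro ⟨i | j, hi⟩
  · simp [rename]
  · rfl

theorem exists_fiber_eq_of_definable {γ : Type x} {R : Set (γ ⊕ Fin n → U)}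
    (hR : Set.univ.Definable L R) :
    ∃ (m : ℕ) (ψ : L.Formula (Fin m ⊕ Fin n)),
      ∀ b : γ → U, ∃ b' : Fin m → U, fiber ψ b' = {z | Sum.elim b z ∈ R} := by
  obtain ⟨φ, rfl⟩ := Set.definable_iff_exists_formula_sum.1 hR
  obtain ⟨m, ψ, hψ⟩ := exists_fiber_eq (U := U)
    (φ.relabel (Equiv.sumAssoc (Set.univ : Set U) γ (Fin n)).symm)
  refine ⟨m, ψ, fun b => (hψ (Sum.elim (↑) b)).imp fun b' hb' => hb'.trans (Set.ext fun z => ?_)⟩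
  rw [Set.mem_ofPred_eq, Formula.realize_relabel]
  refine iff_of_eq (congrArg φ.Realize (funext fun i => ?_))
  rcases i with c | i | j <;> rfl

variable (L D X) in
/-- The set `D` is approximable from below on `X`: uniformly in the finite set `F ⊆ X`, some set
`φ(b, U) ⊆ D` covers `D ∩ F`. For `D ⊆ X`, this is approximability of `D` from below. -/
def ApproximableFromBelowOn : Prop :=
  ∃ (m : ℕ) (φ : L.Formula (Fin m ⊕ Fin n)), ∀ F ⊆ X, F.Finite →
    ∃ b : Fin m → U, D ∩ F ⊆ fiber φ b ∧ fiber φ b ⊆ D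

namespace ApproximableFromBelowOn

theorem of_definable {γ : Type x} {R : Set (γ ⊕ Fin n → U)} (hR : Set.univ.Definable L R)
    (h : ∀ F ⊆ X, F.Finite → ∃ b : γ → U,
      D ∩ F ⊆ {z | Sum.elim b z ∈ R} ∧ {z | Sum.elim b z ∈ R} ⊆ D) :
    ApproximableFromBelowOn L D X := by
  obtain ⟨m, φ, hφ⟩ := exists_fiber_eq_of_definable hR
  refine ⟨m, φ, fun F hFX hF => ?_⟩
  obtain ⟨b, hb⟩ := h F hFX hF
  obtain ⟨b', hb'⟩ := hφ b
  exact ⟨b', hb' ▸ hb⟩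

theorem compl_self : ApproximableFromBelowOn L D Dᶜ :=
  of_definable (γ := Empty) Set.definable_empty fun _ hF _ =>
    ⟨Empty.elim, fun _ hz => hF hz.2 hz.1, Set.empty_subset D⟩

theorem mono (h : ApproximableFromBelowOn L D X) (hYX : Y ⊆ X) : ApproximableFromBelowOn L D Y := by
  obtain ⟨m, φ, h⟩ := h
  exact ⟨m, φ, fun F hFY => h F (hFY.trans hYX)⟩

theorem union (hX : ApproximableFromBelowOn L D X) (hY : ApproximableFromBelowOn L D Y) :
    ApproximableFromBelowOn L D (X ∪ Y) := by
  obtain ⟨m, φ, hφ⟩ := hX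
  obtain ⟨m', ψ, hψ⟩ := hY
  have hdef {α : Type} (χ : L.Formula α) : (Set.univ : Set U).Definable L {v | χ.Realize v} :=
    (Set.empty_definable_iff.2 ⟨χ, rfl⟩).mono (Set.empty_subset _)
  refine of_definable (γ := Fin m ⊕ Fin m')
    (((hdef φ).preimage_comp (Sum.map Sum.inl id)).union
      ((hdef ψ).preimage_comp (Sum.map Sum.inr id))) fun F hFXY hF => ?_
  obtain ⟨b, hb, hbD⟩ := hφ (F ∩ X) Set.inter_subset_right (hF.inter_of_left X)
  obtain ⟨b', hb', hbD'⟩ := hψ (F ∩ Y) Set.inter_subset_right (hF.inter_of_left Y)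
  have hfiber : {z | Sum.elim (Sum.elim b b') z ∈
      (· ∘ Sum.map Sum.inl id) ⁻¹' {v | φ.Realize v} ∪
        (· ∘ Sum.map Sum.inr id) ⁻¹' {v | ψ.Realize v}} = fiber φ b ∪ fiber ψ b' := by
    ext z
    simp only [Set.mem_union, Set.mem_preimage, Set.mem_ofPred_eq, Sum.elim_comp_map,
      Sum.elim_comp_inl, Sum.elim_comp_inr, Function.comp_id]
    rfl
  refine ⟨Sum.elim b b', ?_⟩
  rw [hfiber]
  exact ⟨fun z hz => (hFXY hz.2).imp (fun h => hb ⟨hz.1, hz.2, h⟩) fun h => hb' ⟨hz.1, hz.2, h⟩,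
    Set.union_subset hbD hbD'⟩

theorem approximableFromBelow (h : ApproximableFromBelowOn L D Set.univ) :
    ApproximableFromBelow L D := by
  obtain ⟨m, φ, h⟩ := h
  refine ⟨m, φ, fun B hB => ?_⟩
  obtain ⟨b, hb, hbD⟩ := h (cube B n) (Set.subset_univ _) (Set.Finite.pi' fun _ => hB)
  exact ⟨b, (Set.inter_subset_inter_left _ hbD).antisymm
    (Set.subset_inter hb Set.inter_subset_right), hbD⟩

end ApproximableFromBelowOn

theorem exists_ultrafilter_of_not_approximableFromBelow (h : ¬ ApproximableFromBelow L D) :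
    ∃ W : Ultrafilter (Fin n → U), D ∈ W ∧ ∀ X ∈ W, ¬ ApproximableFromBelowOn L D X := by
  let l : Filter (Fin n → U) := Filter.comk (ApproximableFromBelowOn L D)
    (ApproximableFromBelowOn.compl_self.mono (Set.empty_subset _))
    (fun _ hX _ hYX => hX.mono hYX) fun _ hX _ hY => hX.union hY
  have : l.NeBot := by
    refine ⟨fun hbot => h (ApproximableFromBelowOn.approximableFromBelow ?_)⟩
    simpa only [Set.compl_empty] using Filter.mem_comk.1 (Filter.empty_mem_iff_bot.2 hbot)
  refine ⟨Ultrafilter.of l, Ultrafilter.of_le l ApproximableFromBelowOn.compl_self,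
    fun X hXW hX => ?_⟩
  exact Ultrafilter.compl_mem_iff_notMem.1
    (Ultrafilter.of_le l (Filter.compl_mem_comk.2 hX)) hXW

/-- The `m`-th power of an ultrafilter: `R` belongs to it when, for `W`-almost all `a₀`, for
`W`-almost all `a₁`, and so on, the tuple `(a₀, …, aₘ₋₁)` belongs to `R`. -/
def iteratedPower {Z : Type x} (W : Ultrafilter Z) : ∀ m : ℕ, Ultrafilter (Fin m → Z)
  | 0 => pure Fin.elim0
  | m + 1 => W.bind fun a => (iteratedPower W m).map (Fin.cons a)

theorem mem_iteratedPower_succ {Z : Type x} {W : Ultrafilter Z} {m : ℕ}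
    {R : Set (Fin (m + 1) → Z)} :
    R ∈ iteratedPower W (m + 1) ↔
      ∀ᶠ a in (W : Filter Z), {s | (Fin.cons a s : Fin (m + 1) → Z) ∈ R} ∈ iteratedPower W m :=
  Iff.rfl

variable (L) in
/-- The set `R` of families of `n`-tuples, seen as a set of tuples indexed by `ι × Fin n`, is
definable with parameters. -/
def IsDefinableFamily {ι : Type x} (R : Set (ι → Fin n → U)) : Prop :=
  (Set.univ : Set U).Definable L (Function.curry ⁻¹' R)

theorem IsDefinableFamily.of_formula {ι : Type x} (ψ : L.Formula (ι × Fin n)) :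
    IsDefinableFamily L {s : ι → Fin n → U | ψ.Realize (Function.uncurry s)} :=
  (Set.empty_definable_iff.2 ⟨ψ, rfl⟩).mono (Set.empty_subset _)

theorem IsDefinableFamily.iInter {ι : Type x} {κ : Type y} [Finite κ]
    {R : κ → Set (ι → Fin n → U)} (hR : ∀ k, IsDefinableFamily L (R k)) :
    IsDefinableFamily L (⋂ k, R k) := by
  rw [IsDefinableFamily, Set.preimage_iInter]
  exact Set.definable_iInter_of_finite hR

theorem IsDefinableFamily.setOf_cons_mem {m : ℕ} {R : Set (Fin (m + 1) → Fin n → U)}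
    (hR : IsDefinableFamily L R) (a : Fin n → U) :
    IsDefinableFamily L {s | (Fin.cons a s : Fin (m + 1) → Fin n → U) ∈ R} := by
  refine Set.Definable.preimage_map
    (F := fun g => Function.uncurry (Fin.cons a (Function.curry g))) ?_ hR
  rintro ⟨i, j⟩
  cases i using Fin.cases with
  | zero => exact definableFun_const L _ (Set.mem_univ (a j))
  | succ i => exact Set.DefinableFun.proj L

theorem ApproximableFromBelowOn.of_isDefinableFamily {m : ℕ} {R : Set (Fin (m + 1) → Fin n → U)}
    (hR : IsDefinableFamily L R)
    (h : ∀ F ⊆ X, F.Finite → ∃ s : Fin m → Fin n → U,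
      (∀ a ∈ D ∩ F, (Fin.cons a s : Fin (m + 1) → Fin n → U) ∈ R) ∧
        ∀ a, (Fin.cons a s : Fin (m + 1) → Fin n → U) ∈ R → a ∈ D) :
    ApproximableFromBelowOn L D X := by
  refine of_definable (Set.Definable.preimage_comp (β := (Fin m × Fin n) ⊕ Fin n)
    (fun ij => Fin.cases (Sum.inr ij.2) (fun i => Sum.inl (i, ij.2)) ij.1) hR)
    fun F hFX hF => ?_
  obtain ⟨s, hs⟩ := h F hFX hF
  have hcons (a : Fin n → U) : Sum.elim (Function.uncurry s) a ∘ (fun ij : Fin (m + 1) × Fin n =>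
      Fin.cases (Sum.inr ij.2) (fun i => Sum.inl (i, ij.2)) ij.1) =
        Function.uncurry (Fin.cons a s) := by
    funext ⟨i, j⟩
    cases i using Fin.cases <;> rfl
  refine ⟨Function.uncurry s, ?_⟩
  simp only [Set.mem_preimage, hcons, Function.curry_uncurry]
  exact hs

theorem exists_mem_forall_mem_iff {W : Ultrafilter (Fin n → U)} (hDW : D ∈ W)
    (hW : ∀ X ∈ W, ¬ ApproximableFromBelowOn L D X) {m : ℕ} {R : Set (Fin m → Fin n → U)}
    (hR : IsDefinableFamily L R) (hRW : R ∈ iteratedPower W m) (S : Set (Fin m)) :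
    ∃ s ∈ R, ∀ i, s i ∈ D ↔ i ∈ S := by
  induction m with
  | zero => exact ⟨_, hRW, fun i => i.elim0⟩
  | succ m ih =>
    by_cases hS : 0 ∈ S
    · obtain ⟨a, haR, haD⟩ := (Filter.Eventually.and (mem_iteratedPower_succ.1 hRW) hDW).exists
      obtain ⟨s, hsR, hsS⟩ := ih (hR.setOf_cons_mem a) haR (Fin.succ ⁻¹' S)
      exact ⟨_, hsR, Fin.cases (iff_of_true haD hS) hsS⟩
    · by_contra hno
      refine hW _ (mem_iteratedPower_succ.1 hRW) (.of_isDefinableFamily hR fun F hFX hF => ?_)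
      have : Finite F := hF
      obtain ⟨s, hsR, hsS⟩ := ih (IsDefinableFamily.iInter fun a : F => hR.setOf_cons_mem a.1)
        (Filter.iInter_mem.2 fun a : F => hFX a.2) (Fin.succ ⁻¹' S)
      refine ⟨s, fun a ha => Set.mem_iInter.1 hsR ⟨a, ha.2⟩, fun a haR => ?_⟩
      by_contra haD
      exact hno ⟨_, haR, Fin.cases (iff_of_false haD hS) hsS⟩

end LowerApproximation

section FiniteVCDimension

variable {L : FirstOrder.Language.{u, v}} {U : Type w} [L.Structure U] [Infinite U] {n : ℕ}
  {D : Set (Fin n → U)}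

theorem IsSaturated.exists_forall_exists_mem_eClass (hU : IsSaturated L U)
    (hL : lift.{w} L.card ≤ lift.{max u v} #U) (hD : ¬ ApproximableFromBelow L D) (k : ℕ) :
    ∃ c : Fin k → Fin n → U, ∀ S : Set (Fin k), ∃ C ∈ eClass L D, ∀ i, c i ∈ C ↔ i ∈ S := by
  obtain ⟨W, hDW, hW⟩ := exists_ultrafilter_of_not_approximableFromBelow hD
  obtain ⟨y, hy⟩ := hU.exists_realize_of_ultrafilter ((iteratedPower W k).map Function.uncurry)
  refine ⟨Function.curry y, fun S => hU.exists_mem_eClass_trace hL fun χ hχ => ?_⟩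
  obtain ⟨ψ, hψ, hext⟩ := exists_formula_extending_of_finite (N := U) y hχ
  obtain ⟨s, hs, hsS⟩ :=
    exists_mem_forall_mem_iff hDW hW (IsDefinableFamily.of_formula ψ) (hy ψ hψ) S
  obtain ⟨g, hg, hχg⟩ := hext _ hs
  have hgs (i : Fin k) : g ∘ Function.curry y i = s i := funext fun j => congrFun hg (i, j)
  exact ⟨g, hχg, fun i => by rw [hgs, hsS]⟩

theorem IsSaturated.approximableFromBelow_of_finiteVCDim (hU : IsSaturated L U)
    (hL : lift.{w} L.card ≤ lift.{max u v} #U) (hD : FiniteVCDim (eClass L D)) :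
    ApproximableFromBelow L D := by
  by_contra h
  exact not_finiteVCDim_of_forall_exists (hU.exists_forall_exists_mem_eClass hL h) hD

end FiniteVCDimension

end ExtDef

theorem mainTheorem3_general (L : FirstOrder.Language.{u, v}) (U : Type w) [L.Structure U]
    [Infinite U] (hU : ExtDef.IsSaturated L U) (hL : lift.{w} L.card ≤ lift.{max u v} #U)
    (hNIP : ExtDef.IsNIP L U) (n : ℕ) (D : Set (Fin n → U)) :
    (ExtDef.ApproximableFromBelow L D ↔ ExtDef.FiniteVCDim (ExtDef.eClass L D)) ∧
    (ExtDef.ExternallyDefinable L D ↔ ExtDef.FiniteVCDim (ExtDef.eClass L D)) := by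
  have hbelow : ExtDef.FiniteVCDim (ExtDef.eClass L D) → ExtDef.ApproximableFromBelow L D :=
    hU.approximableFromBelow_of_finiteVCDim hL
  refine ⟨⟨?_, hbelow⟩, fun h => ?_, fun h => ?_⟩
  · rintro ⟨m, φ, hφ⟩
    exact hφ.approximableBy.finiteVCDim_eClass (hNIP m n φ)
  · obtain ⟨m, φ, hφ⟩ := ExtDef.externallyDefinable_iff_exists_approximableBy.1 h
    exact hφ.finiteVCDim_eClass (hNIP m n φ)
  · obtain ⟨m, φ, hφ⟩ := hbelow h
    exact ExtDef.externallyDefinable_iff_exists_approximableBy.2 ⟨m, φ, hφ.approximableBy⟩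

theorem mainTheorem3 (L : FirstOrder.Language.{u, v}) (U : Type w) [L.Structure U]
    (hU : ExtDef.IsSaturated L U)
    (hκ : Cardinal.IsInaccessible (Cardinal.mk U))
    (hL : Cardinal.lift.{w} L.card < Cardinal.lift.{max u v} (Cardinal.mk U))
    (hNIP : ExtDef.IsNIP L U) (n : ℕ) (D : Set (Fin n → U)) :
    (ExtDef.ApproximableFromBelow L D ↔ ExtDef.FiniteVCDim (ExtDef.eClass L D)) ∧
    (ExtDef.ExternallyDefinable L D ↔ ExtDef.FiniteVCDim (ExtDef.eClass L D)) := by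
  have : Infinite U := Cardinal.infinite_iff.2 hκ.1.le
  exact mainTheorem3_general L U hU hL.le hNIP n D
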